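/- Let $n,k\ge 0$ be integers, let $\Omega\subset\mathbb{R}^n$ be compact, let $\phi:\Omega\times[0,\infty)\to\mathbb{R}$ be continuous, and let $\tau>0$. Let $\sigma:\mathbb{R}\to\mathbb{R}$ be a $C^k$ function that is not a polynomial. A neural network with activation function $\sigma$ is a function of the form $$G(x)=\sum_{j=1}^{N} a_j\,\sigma(y_j^{T}x+\theta_j),\qquad N\in\mathbb{N},\ a_j,\theta_j\in\mathbb{R},\ y_j\in\mathbb{R}^n .$$ Let $\rho,\pi$ be $C^k$ probability densities on $\Omega$, that is, functions of class $C^k$ on $\Omega$ which are non-negative on $\Omega$ and have integral $1$ over $\Omega$; a density $u$ is identified with the measure $u(x)\,dx$ on $\Omega$. For a $C^k$ probability density $u$ on $\Omega$ put $$\mathcal{I}(u)=\int_\Omega \phi(x,u(x))\,dx+\frac{\mathbb{W}_2^2(u,\pi)}{2\tau},\qquad \mathbb{W}_2^2(u,\pi)=\inf_{\gamma\in\Pi(u,\pi)}\int \|x-y\|_2^2\,d\gamma(x,y),$$ where $\Pi(u,\pi)$ is the set of measures on $\mathbb{R}^n\times\mathbb{R}^n$ with marginals $u(x)\,dx$ and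 $\pi(x)\,dx$. Then for every $\varepsilon>0$ there is a neural network $u_\theta$ with activation function $\sigma$ such that $u_\theta\ge 0$ on $\Omega$, $\int_\Omega u_\theta>0$, the normalization $\widetilde{u_\theta}=\frac{1}{\int_\Omega u_\theta}u_\theta$ is a $C^k$ probability density on $\Omega$, and $$\|\widetilde{u_\theta}-\rho\|_{L^\infty(\Omega)}\le\varepsilon\qquad\text{and}\qquad \mathcal{I}(\widetilde{u_\theta})-\mathcal{I}(\rho)\le\varepsilon .$$ -/

import Mathlib

open MeasureTheory
open scoped ENNReal

noncomputable section

/-- The one-hidden-layer neural network `x ↦ ∑ j, a j * σ (⟨y j, x⟩ + θ j)` with activation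
function `σ`. -/
def neuralNetwork {n N : ℕ} (σ : ℝ → ℝ) (a : Fin N → ℝ) (y : Fin N → EuclideanSpace ℝ (Fin n))
    (θ : Fin N → ℝ) (x : EuclideanSpace ℝ (Fin n)) : ℝ :=
  ∑ j, a j * σ (inner ℝ (y j) x + θ j)

/-- `u` is the density, with respect to Lebesgue measure, of a probability distribution on `Ω`,
and is of class `C^k` on `Ω`. Only the values of `u` on `Ω` matter. -/
structure IsCkProbDensity {n : ℕ} (k : ℕ) (Ω : Set (EuclideanSpace ℝ (Fin n)))
    (u : EuclideanSpace ℝ (Fin n) → ℝ) : Prop where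
  contDiffOn : ContDiffOn ℝ k u Ω
  nonneg : ∀ x ∈ Ω, 0 ≤ u x
  integrableOn : IntegrableOn u Ω
  integral_eq_one : ∫ x in Ω, u x = 1

/-- The measure `u(x) dx` on `Ω`, as a measure on `ℝⁿ` that vanishes outside `Ω`. -/
def densityMeasure {n : ℕ} (Ω : Set (EuclideanSpace ℝ (Fin n)))
    (u : EuclideanSpace ℝ (Fin n) → ℝ) : Measure (EuclideanSpace ℝ (Fin n)) :=
  (volume.restrict Ω).withDensity fun x => ENNReal.ofReal (u x)

/-- The set `Π(μ, ν)` of transport plans: measures on the product with marginals `μ` and `ν`. -/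
def transportPlans {X : Type*} [MeasurableSpace X] (μ ν : Measure X) : Set (Measure (X × X)) :=
  {γ | γ.map Prod.fst = μ ∧ γ.map Prod.snd = ν}

/-- The optimal value of the Kantorovich problem with the cost `‖x - y‖²`. -/
def kantorovichCost {n : ℕ} (μ ν : Measure (EuclideanSpace ℝ (Fin n))) : ℝ≥0∞ :=
  ⨅ γ ∈ transportPlans μ ν, ∫⁻ p, ENNReal.ofReal (‖p.1 - p.2‖ ^ 2) ∂γ

/-- The `L²`-Wasserstein distance. -/
def wasserstein2 {n : ℕ} (μ ν : Measure (EuclideanSpace ℝ (Fin n))) : ℝ :=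
  Real.sqrt (kantorovichCost μ ν).toReal

/-- The functional `I(u) = ∫_Ω φ(x, u(x)) dx + W₂²(u, π) / (2τ)`. -/
def jkoFunctional {n : ℕ} (Ω : Set (EuclideanSpace ℝ (Fin n)))
    (φ : EuclideanSpace ℝ (Fin n) → ℝ → ℝ) (τ : ℝ) (π u : EuclideanSpace ℝ (Fin n) → ℝ) : ℝ :=
  (∫ x in Ω, φ x (u x)) +
    wasserstein2 (densityMeasure Ω u) (densityMeasure Ω π) ^ 2 / (2 * τ)

/-- The normalization `ũ = u / ∫_Ω u`. -/
def normalizeOn {n : ℕ} (Ω : Set (EuclideanSpace ℝ (Fin n)))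
    (u : EuclideanSpace ℝ (Fin n) → ℝ) (x : EuclideanSpace ℝ (Fin n)) : ℝ :=
  (∫ z in Ω, u z)⁻¹ * u x

end

/-! Only an upper bound on the functional is needed, so one-sided approximation suffices. By
universal approximation a network `u` lies within `δ` of `ρ + δ` on `Ω`, so `ρ ≤ u ≤ ρ + 2δ`. Its
mass `Z` is at least 1 and close to 1, and the normalization is uniformly close to `ρ` and dominates
`Z⁻¹ ρ`. Hence it can be transported to `π` by scaling any plan for `ρ` by `Z⁻¹` and coupling the
remainder, of mass `1 - Z⁻¹`, independently with `π`; the extra cost is at most `diam(Ω)² (1 - Z⁻¹)`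
(`wasserstein2_sq_le`). The `φ` term is controlled by uniform continuity.

Universal approximation (`eq_top_of_ridge_mem`): a closed subspace containing all `σ(c h + θ)` also
contains the ridge functions of mollified `σ`, and their derivatives in `c`. If `h ^ m` were
missing, every mollification would be a polynomial of degree below `m`, and so would the limit `σ`.
So all powers of `h`, hence `exp h`, belong to the subspace, and Stone–Weierstrass applies to the
exponentials. -/

theorem Submodule.integral_mem_of_isClosed {α E : Type*} [MeasurableSpace α] {μ : Measure α}
    [NormedAddCommGroup E] [NormedSpace ℝ E] [CompleteSpace E] {V : Submodule ℝ E}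
    (hV : IsClosed (V : Set E)) {f : α → E} (hf : Integrable f μ) (hfV : ∀ a, f a ∈ V) :
    ∫ a, f a ∂μ ∈ V := by
  by_contra h
  obtain ⟨ℓ, u, hu, hu'⟩ := geometric_hahn_banach_closed_point V.convex hV h
  have hzero : ∀ v ∈ V, ℓ v = 0 := by
    intro v hv
    by_contra hne
    -- The multiple is chosen so that `ℓ` takes the value `u + 1` there, above its bound `u`.
    have := hu (((u + 1) / ℓ v) • v) (V.smul_mem _ hv)
    rw [map_smul, smul_eq_mul, div_mul_cancel₀ _ hne] at this
    linarith
  have h0 : 0 < u := by simpa using hu 0 V.zero_mem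
  rw [← ℓ.integral_comp_comm hf] at hu'
  simp [hzero _ (hfV _)] at hu'
  linarith

/-! ### Ridge functions in a closed subspace -/

section Ridge

variable {X : Type*} [TopologicalSpace X]

/-- The function `x ↦ g (c * h x + θ)`. -/
def ridge (g : C(ℝ, ℝ)) (h : C(X, ℝ)) (c θ : ℝ) : C(X, ℝ) :=
  ⟨fun x => g (c * h x + θ), by fun_prop⟩

@[simp]
theorem ridge_apply (g : C(ℝ, ℝ)) (h : C(X, ℝ)) (c θ : ℝ) (x : X) :
    ridge g h c θ x = g (c * h x + θ) := rfl

variable [CompactSpace X]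

/-- The convolved ridge function is a Bochner integral in `C(X, ℝ)` of multiples of translated ones.
-/
theorem ridge_convolution_mem {V : Submodule ℝ C(X, ℝ)} (hV : IsClosed (V : Set C(X, ℝ)))
    {g G : C(ℝ, ℝ)} {h : C(X, ℝ)} (hg : ∀ c θ, ridge g h c θ ∈ V) {b : ℝ → ℝ}
    (hb : Continuous b) (hbc : HasCompactSupport b)
    (hG : ∀ t, G t = ∫ s, b s * g (t - s)) (c θ : ℝ) : ridge G h c θ ∈ V := by
  let F : ℝ → C(X, ℝ) := ContinuousMap.curry
    ⟨fun p : ℝ × X => b p.1 * g (c * h p.2 + (θ - p.1)), by fun_prop⟩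
  have hFs : ∀ s, F s = b s • ridge g h c (θ - s) := fun s => by ext x; simp [F]
  have hF : Continuous F := ContinuousMap.continuous _
  have hFc : HasCompactSupport F := by
    refine hbc.mono fun s hs hbs => hs ?_
    rw [hFs, hbs, zero_smul]
  have hFi : Integrable F := hF.integrable_of_hasCompactSupport hFc
  have heq : ridge G h c θ = ∫ s, F s := by
    ext x
    have := (ContinuousMap.evalCLM ℝ x).integral_comp_comm hFi
    simp only [ContinuousMap.evalCLM_apply] at this
    rw [← this, ridge_apply, hG]
    refine integral_congr_ae (.of_forall fun s => ?_)
    simp [F, add_sub_assoc]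
  rw [heq]
  refine Submodule.integral_mem_of_isClosed hV hFi fun s => ?_
  rw [hFs]
  exact V.smul_mem _ (hg _ _)

/-- Differentiating in `c`, not `θ`, produces the factor `h`. Writing increments as integrals of a
continuous `C(X, ℝ)`-valued curve makes the difference quotients converge uniformly. -/
theorem pow_succ_mul_ridge_deriv_mem {V : Submodule ℝ C(X, ℝ)}
    (hV : IsClosed (V : Set C(X, ℝ))) {g g' : C(ℝ, ℝ)} {h : C(X, ℝ)} {j : ℕ}
    (hg : ∀ c θ, h ^ j * ridge g h c θ ∈ V) (hg' : ∀ t, HasDerivAt g (g' t) t) (c θ : ℝ) :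
    h ^ (j + 1) * ridge g' h c θ ∈ V := by
  let B : ℝ → C(X, ℝ) := ContinuousMap.curry
    ⟨fun p : ℝ × X => h p.2 ^ (j + 1) * g' (p.1 * h p.2 + θ), by fun_prop⟩
  have hB : Continuous B := ContinuousMap.continuous _
  have hint : ∀ u, ∫ s in c..u, B s = h ^ j * ridge g h u θ - h ^ j * ridge g h c θ := by
    intro u
    ext x
    have := (ContinuousMap.evalCLM ℝ x).intervalIntegral_comp_comm
      (hB.intervalIntegrable (μ := volume) c u)
    simp only [ContinuousMap.evalCLM_apply] at this
    rw [← this]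
    have hd : ∀ s ∈ Set.uIcc c u,
        HasDerivAt (fun s => h x ^ j * g (s * h x + θ)) (B s x) s := by
      intro s _
      have h1 : HasDerivAt (fun s => s * h x + θ) (h x) s := by
        simpa using ((hasDerivAt_id s).mul_const (h x)).add_const θ
      have h2 := ((hg' (s * h x + θ)).comp s h1).const_mul (h x ^ j)
      refine h2.congr_deriv ?_
      change h x ^ j * (g' (s * h x + θ) * h x) = h x ^ (j + 1) * g' (s * h x + θ)
      ring
    exact intervalIntegral.integral_eq_sub_of_hasDerivAt hd
      (((ContinuousMap.evalCLM ℝ x).continuous.comp hB).intervalIntegrable c u)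
  have hderiv : HasDerivAt (fun u => ∫ s in c..u, B s) (B c) c :=
    intervalIntegral.integral_hasDerivAt_right (by simp)
      (hB.stronglyMeasurableAtFilter _ _) hB.continuousAt
  have hBc : B c = h ^ (j + 1) * ridge g' h c θ := by ext x; simp [B]
  rw [← hBc]
  refine hV.mem_of_tendsto (hasDerivAt_iff_tendsto_slope.1 hderiv) (.of_forall fun u => ?_)
  rw [slope_def_module]
  refine V.smul_mem _ ?_
  rw [intervalIntegral.integral_same, sub_zero, hint]
  exact V.sub_mem (hg _ _) (hg _ _)

theorem pow_mul_ridge_iteratedDeriv_mem {V : Submodule ℝ C(X, ℝ)}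
    (hV : IsClosed (V : Set C(X, ℝ))) {g : C(ℝ, ℝ)} {h : C(X, ℝ)}
    (hg : ∀ c θ, ridge g h c θ ∈ V) (hsmooth : ∀ m : ℕ, ContDiff ℝ m g) (m : ℕ) (c θ : ℝ) :
    h ^ m * ridge ⟨iteratedDeriv m g, (hsmooth m).continuous_iteratedDeriv' m⟩ h c θ ∈ V := by
  induction m generalizing c θ with
  | zero =>
    convert hg c θ using 1
    ext x
    simp
  | succ m ih =>
    refine pow_succ_mul_ridge_deriv_mem hV ih (fun t => ?_) c θ
    have := ((hsmooth (m + 1)).differentiable_iteratedDeriv m (by exact_mod_cast m.lt_succ_self)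
      t).hasDerivAt
    rwa [← iteratedDeriv_succ] at this

end Ridge

/-! ### Polynomials and non-polynomial activations -/

theorem exists_polynomial_of_iteratedDeriv_eq_zero {m : ℕ} {g : ℝ → ℝ} (hg : ContDiff ℝ m g)
    (h : ∀ t, iteratedDeriv m g t = 0) :
    ∃ p ∈ Polynomial.degreeLT ℝ m, ∀ t, g t = p.eval t := by
  induction m generalizing g with
  | zero => exact ⟨0, Submodule.zero_mem _, fun t => by simpa using h t⟩
  | succ m ih =>
    have hg' : ContDiff ℝ ((m : WithTop ℕ∞) + 1) g := by exact_mod_cast hg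
    obtain ⟨p, hp, hpg⟩ := ih (contDiff_succ_iff_deriv.1 hg').2.2
      fun t => by rw [← iteratedDeriv_succ']; exact h t
    let q : Polynomial ℝ := ∑ i ∈ Finset.range m,
      Polynomial.monomial (i + 1) (p.coeff i / (i + 1)) + Polynomial.C (g 0)
    have hqp : Polynomial.derivative q = p := by
      ext i
      simp only [q, Polynomial.coeff_derivative, Polynomial.coeff_add, Polynomial.finsetSum_coeff,
        Polynomial.coeff_monomial, Polynomial.coeff_C_succ, add_left_inj, Finset.sum_ite_eq',
        Finset.mem_range, add_zero]
      split_ifs with hi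
      · field_simp
      · rw [zero_mul, Polynomial.coeff_eq_zero_of_degree_lt]
        exact (Polynomial.mem_degreeLT.1 hp).trans_le (by exact_mod_cast not_lt.1 hi)
    refine ⟨q, ?_, fun t => ?_⟩
    · refine Submodule.add_mem _ (Submodule.sum_mem _ fun i hi => ?_) ?_
      · refine Polynomial.mem_degreeLT.2 ((Polynomial.degree_monomial_le _ _).trans_lt ?_)
        exact_mod_cast Nat.succ_lt_succ (Finset.mem_range.1 hi)
      · exact Polynomial.mem_degreeLT.2
          (Polynomial.degree_C_le.trans_lt (by exact_mod_cast m.succ_pos))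
    · have hgd : Differentiable ℝ g := hg'.differentiable (by simp)
      have hconst := is_const_of_deriv_eq_zero (f := fun t => g t - q.eval t)
        (hgd.sub q.differentiable) (fun s => by
          rw [deriv_fun_sub (hgd s) q.differentiableAt, Polynomial.deriv, hqp, hpg, sub_self]) t 0
      have hq0 : q.eval 0 = g 0 := by simp [q, Polynomial.eval_finsetSum]
      simp only [hq0, sub_self] at hconst
      linarith

/-- The uniform degree bound confines the sequence to a finite-dimensional subspace of `ℝ → ℝ`,
closed even for pointwise convergence. -/
theorem exists_polynomial_of_tendsto {m : ℕ} {f : ℕ → ℝ → ℝ} {g : ℝ → ℝ}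
    (hf : ∀ i, ∃ p ∈ Polynomial.degreeLT ℝ m, ∀ t, f i t = p.eval t)
    (hlim : ∀ t, Filter.Tendsto (fun i => f i t) Filter.atTop (nhds (g t))) :
    ∃ p : Polynomial ℝ, ∀ t, g t = p.eval t := by
  let e : Polynomial ℝ →ₗ[ℝ] (ℝ → ℝ) := LinearMap.pi fun t => Polynomial.leval t
  have : FiniteDimensional ℝ ((Polynomial.degreeLT ℝ m).map e) := inferInstance
  have hc := ((Polynomial.degreeLT ℝ m).map e).closed_of_finiteDimensional
  obtain ⟨p, -, hp⟩ := hc.mem_of_tendsto (tendsto_pi_nhds.2 hlim) (.of_forall fun i => by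
    obtain ⟨p, hp, hp'⟩ := hf i
    exact ⟨p, hp, funext fun t => (hp' t).symm⟩)
  exact ⟨p, fun t => (congrFun hp t).symm⟩

theorem pow_mem_of_ridge_mem {X : Type*} [TopologicalSpace X] [CompactSpace X]
    {V : Submodule ℝ C(X, ℝ)} (hV : IsClosed (V : Set C(X, ℝ))) {σ : C(ℝ, ℝ)}
    (hσ : ¬ ∃ p : Polynomial ℝ, ∀ t, σ t = p.eval t) {h : C(X, ℝ)}
    (hmem : ∀ c θ, ridge σ h c θ ∈ V) (m : ℕ) : h ^ m ∈ V := by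
  by_contra hm
  refine hσ ?_
  let b : ℕ → ContDiffBump (0 : ℝ) := fun i =>
    ⟨1 / (i + 2), 1 / (i + 1), by positivity, by gcongr; norm_num⟩
  let G : ℕ → ℝ → ℝ := fun i =>
    convolution ((b i).normed volume) σ (ContinuousLinearMap.lsmul ℝ ℝ) volume
  have hsmooth : ∀ i (n : ℕ), ContDiff ℝ n (G i) := fun i n =>
    (b i).hasCompactSupport_normed.contDiff_convolution_left (n := n) _
      ((b i).contDiff_normed) σ.continuous.locallyIntegrable
  have hr : Filter.Tendsto (fun i => (b i).rOut) Filter.atTop (nhds 0) :=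
    tendsto_one_div_add_atTop_nhds_zero_nat
  refine exists_polynomial_of_tendsto (m := m) (f := G) (fun i => ?_) fun t =>
    ContDiffBump.convolution_tendsto_right_of_continuous hr σ.continuous t
  refine exists_polynomial_of_iteratedDeriv_eq_zero (hsmooth i m) fun t => ?_
  by_contra ht
  let Gi : C(ℝ, ℝ) := ⟨G i, (hsmooth i 0).continuous⟩
  have hGi : ∀ c θ, ridge Gi h c θ ∈ V := ridge_convolution_mem hV hmem
    (b i).continuous_normed (b i).hasCompactSupport_normed (fun t => rfl)
  -- At `c = 0` the ridge factor is a nonzero constant, leaving a multiple of `h ^ m`.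
  have := V.smul_mem (iteratedDeriv m Gi t)⁻¹
    (pow_mul_ridge_iteratedDeriv_mem hV hGi (hsmooth i) m 0 t)
  refine hm ?_
  convert this using 1
  ext x
  have ht' : iteratedDeriv m Gi t ≠ 0 := ht
  simp only [ContinuousMap.smul_apply, ContinuousMap.mul_apply, ridge_apply,
    ContinuousMap.coe_mk, zero_mul, zero_add, smul_eq_mul, ContinuousMap.pow_apply]
  field_simp


/-! ### Exponentials and universal approximation -/

theorem NormedSpace.exp_mem_of_pow_mem {X : Type*} [TopologicalSpace X] [CompactSpace X]
    {V : Submodule ℝ C(X, ℝ)} (hV : IsClosed (V : Set C(X, ℝ))) {h : C(X, ℝ)}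
    (hh : ∀ m : ℕ, h ^ m ∈ V) : NormedSpace.exp h ∈ V := by
  refine hV.mem_of_tendsto (NormedSpace.exp_series_hasSum_exp' (𝕂 := ℝ) h)
    (.of_forall fun s => ?_)
  exact V.sum_mem fun i _ => V.smul_mem _ (hh i)

theorem ContinuousMap.exp_apply {X : Type*} [TopologicalSpace X] [CompactSpace X] (h : C(X, ℝ))
    (x : X) : NormedSpace.exp h x = Real.exp (h x) := by
  rw [Real.exp_eq_exp_ℝ]
  exact NormedSpace.map_exp (ContinuousMap.evalAlgHom ℝ ℝ x) (by fun_prop) h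

/-- Ridge functions with a continuous non-polynomial profile, built from a separating additive
monoid of functions, span a dense subspace. -/
theorem eq_top_of_ridge_mem {X : Type*} [TopologicalSpace X] [CompactSpace X]
    {V : Submodule ℝ C(X, ℝ)} (hV : IsClosed (V : Set C(X, ℝ))) {σ : C(ℝ, ℝ)}
    (hσ : ¬ ∃ p : Polynomial ℝ, ∀ t, σ t = p.eval t) (A : AddSubmonoid C(X, ℝ))
    (hA : ∀ x y, x ≠ y → ∃ h ∈ A, h x ≠ h y)
    (hmem : ∀ h ∈ A, ∀ c θ, ridge σ h c θ ∈ V) : V = ⊤ := by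
  let M : Submonoid C(X, ℝ) :=
    { carrier := NormedSpace.exp '' A
      one_mem' := ⟨0, A.zero_mem, NormedSpace.exp_zero⟩
      mul_mem' := by
        rintro _ _ ⟨f, hf, rfl⟩ ⟨g, hg, rfl⟩
        exact ⟨f + g, A.add_mem hf hg, NormedSpace.exp_add⟩ }
  have hle : Subalgebra.toSubmodule (Algebra.adjoin ℝ (M : Set C(X, ℝ))) ≤ V := by
    -- The exponentials are closed under products, so the algebra they generate is just their linear
    -- span.
    rw [Algebra.adjoin_eq_span, Submonoid.closure_eq, Submodule.span_le]
    rintro _ ⟨h, hh, rfl⟩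
    exact NormedSpace.exp_mem_of_pow_mem hV (pow_mem_of_ridge_mem hV hσ (hmem h hh))
  have htop := ContinuousMap.subalgebra_topologicalClosure_eq_top_of_separatesPoints
    (Algebra.adjoin ℝ (M : Set C(X, ℝ))) (by
      intro x y hxy
      obtain ⟨h, hh, hne⟩ := hA x y hxy
      refine ⟨_, ⟨NormedSpace.exp h, Algebra.subset_adjoin ⟨h, hh, rfl⟩, rfl⟩, ?_⟩
      simpa [ContinuousMap.exp_apply] using hne)
  refine eq_top_iff.2 fun f _ => ?_
  have hf : f ∈ (Algebra.adjoin ℝ (M : Set C(X, ℝ))).topologicalClosure := by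
    rw [htop]; trivial
  exact hV.closure_subset_iff.2 hle hf

/-- Universal approximation on compact sets by networks with a continuous non-polynomial
activation function. -/
theorem exists_neuralNetwork_approx {n : ℕ} {Ω : Set (EuclideanSpace ℝ (Fin n))}
    (hΩ : IsCompact Ω) {σ : ℝ → ℝ} (hσc : Continuous σ)
    (hσ : ¬ ∃ p : Polynomial ℝ, ∀ t, σ t = p.eval t) {f : EuclideanSpace ℝ (Fin n) → ℝ}
    (hf : ContinuousOn f Ω) {δ : ℝ} (hδ : 0 < δ) :
    ∃ (N : ℕ) (a : Fin N → ℝ) (y : Fin N → EuclideanSpace ℝ (Fin n)) (θ : Fin N → ℝ),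
      ∀ x ∈ Ω, |neuralNetwork σ a y θ x - f x| < δ := by
  have : CompactSpace Ω := isCompact_iff_compactSpace.1 hΩ
  let s : C(ℝ, ℝ) := ⟨σ, hσc⟩
  let ℓ : EuclideanSpace ℝ (Fin n) →+ C(Ω, ℝ) :=
    { toFun := fun y => ⟨fun x => inner ℝ y x, by fun_prop⟩
      map_zero' := by ext; simp
      map_add' := fun y z => by ext; simp [inner_add_left] }
  let S : Set C(Ω, ℝ) := Set.range fun p : EuclideanSpace ℝ (Fin n) × ℝ => ridge s (ℓ p.1) 1 p.2
  have htop : (Submodule.span ℝ S).topologicalClosure = ⊤ := by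
    refine eq_top_of_ridge_mem (Submodule.isClosed_topologicalClosure _) (σ := s) hσ
      (AddMonoidHom.mrange ℓ) (fun x y hxy => ?_) ?_
    · refine ⟨_, ⟨(x : EuclideanSpace ℝ (Fin n)) - y, rfl⟩, fun h => hxy ?_⟩
      have h' : inner ℝ ((x : EuclideanSpace ℝ (Fin n)) - y)
          (x : EuclideanSpace ℝ (Fin n)) =
          inner ℝ ((x : EuclideanSpace ℝ (Fin n)) - y) (y : EuclideanSpace ℝ (Fin n)) := h
      rw [← sub_eq_zero, ← inner_sub_right, inner_self_eq_zero, sub_eq_zero] at h'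
      exact Subtype.ext h'
    · rintro _ ⟨y, rfl⟩ c θ
      refine Submodule.le_topologicalClosure _ (Submodule.subset_span ⟨(c • y, θ), ?_⟩)
      ext x
      simp [ℓ, inner_smul_left]
  let F : C(Ω, ℝ) := ⟨Ω.domRestrict f, hf.domRestrict⟩
  have hF : F ∈ closure (Submodule.span ℝ S : Set C(Ω, ℝ)) := by
    rw [← Submodule.topologicalClosure_coe, htop]; trivial
  obtain ⟨g, hg, hgF⟩ := Metric.mem_closure_iff.1 hF δ hδ
  obtain ⟨N, a, v, rfl⟩ := Submodule.mem_span_set'.1 hg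
  choose p hp using fun i => (v i).2
  refine ⟨N, a, fun i => (p i).1, fun i => (p i).2, fun x hx => ?_⟩
  have := (ContinuousMap.dist_lt_iff hδ).1 hgF ⟨x, hx⟩
  rw [dist_comm, Real.dist_eq] at this
  convert this using 3
  · simp [neuralNetwork, ContinuousMap.sum_apply, ← hp, ℓ, s]
  · rfl

/-! ### Transport cost, internal energy and normalization -/

section Density

variable {n : ℕ}

/-- The plan `c • γ + η.prod ν` is admissible: its second marginal is `(c + η univ) • ν = ν`. -/
theorem kantorovichCost_smul_add_le {μ η ν : Measure (EuclideanSpace ℝ (Fin n))} {c : ℝ≥0∞}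
    [SFinite η] [IsProbabilityMeasure ν] (hc : c + η Set.univ = 1) :
    kantorovichCost (c • μ + η) ν ≤
      kantorovichCost μ ν + ∫⁻ p, ENNReal.ofReal (‖p.1 - p.2‖ ^ 2) ∂(η.prod ν) := by
  rw [kantorovichCost, kantorovichCost]
  simp_rw [ENNReal.iInf_add]
  refine le_iInf₂ fun γ hγ => ?_
  refine (iInf₂_le (c • γ + η.prod ν) ⟨?_, ?_⟩).trans ?_
  · rw [lintegral_add_measure, lintegral_smul_measure]
    gcongr
    exact mul_le_of_le_one_left' (hc ▸ le_self_add)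
  · rw [Measure.map_add _ _ measurable_fst, Measure.map_smul, hγ.1, Measure.map_fst_prod,
      measure_univ, one_smul]
  · rw [Measure.map_add _ _ measurable_snd, Measure.map_smul, hγ.2, Measure.map_snd_prod,
      ← add_smul, hc, one_smul]

theorem kantorovichCost_le_lintegral_prod (μ ν : Measure (EuclideanSpace ℝ (Fin n)))
    [IsProbabilityMeasure μ] [IsProbabilityMeasure ν] :
    kantorovichCost μ ν ≤ ∫⁻ p, ENNReal.ofReal (‖p.1 - p.2‖ ^ 2) ∂(μ.prod ν) := by
  refine iInf₂_le _ ⟨?_, ?_⟩ <;> simp [Measure.map_fst_prod, Measure.map_snd_prod]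

variable {Ω : Set (EuclideanSpace ℝ (Fin n))}

theorem densityMeasure_univ {u : EuclideanSpace ℝ (Fin n) → ℝ} (hΩ : MeasurableSet Ω)
    (hu : IntegrableOn u Ω) (h0 : ∀ x ∈ Ω, 0 ≤ u x) :
    densityMeasure Ω u Set.univ = ENNReal.ofReal (∫ x in Ω, u x) := by
  rw [densityMeasure, withDensity_apply _ .univ, Measure.restrict_univ,
    ofReal_integral_eq_lintegral_ofReal hu (ae_restrict_of_forall_mem hΩ h0)]

theorem IsCkProbDensity.isProbabilityMeasure {k : ℕ} {u : EuclideanSpace ℝ (Fin n) → ℝ}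
    (hu : IsCkProbDensity k Ω u) (hΩ : MeasurableSet Ω) :
    IsProbabilityMeasure (densityMeasure Ω u) :=
  ⟨by rw [densityMeasure_univ hΩ hu.integrableOn hu.nonneg, hu.integral_eq_one,
    ENNReal.ofReal_one]⟩

instance (u : EuclideanSpace ℝ (Fin n) → ℝ) : SFinite (densityMeasure Ω u) := by
  unfold densityMeasure; infer_instance

theorem lintegral_prod_densityMeasure_le (hΩ : IsCompact Ω)
    (u v : EuclideanSpace ℝ (Fin n) → ℝ) :
    ∫⁻ p, ENNReal.ofReal (‖p.1 - p.2‖ ^ 2) ∂((densityMeasure Ω u).prod (densityMeasure Ω v)) ≤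
      ENNReal.ofReal (Metric.diam Ω ^ 2) *
        (densityMeasure Ω u Set.univ * densityMeasure Ω v Set.univ) := by
  have hm := hΩ.measurableSet
  have key : ∀ w : EuclideanSpace ℝ (Fin n) → ℝ,
      densityMeasure Ω w = (volume.withDensity fun x => ENNReal.ofReal (w x)).restrict Ω :=
    fun w => (restrict_withDensity hm _).symm
  rw [key u, key v, Measure.prod_restrict]
  refine (setLIntegral_mono' (hm.prod hm)
    (g := fun _ => ENNReal.ofReal (Metric.diam Ω ^ 2)) fun p hp => ?_).trans ?_
  · gcongr
    rw [← dist_eq_norm]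
    exact Metric.dist_le_diam_of_mem hΩ.isBounded hp.1 hp.2
  · simp [Measure.prod_prod]

theorem densityMeasure_eq_smul_add {u ρ : EuclideanSpace ℝ (Fin n) → ℝ} {c : ℝ}
    (hΩ : MeasurableSet Ω) (hρ : IntegrableOn ρ Ω) (hρ0 : ∀ x ∈ Ω, 0 ≤ ρ x) (hc : 0 ≤ c)
    (h : ∀ x ∈ Ω, c * ρ x ≤ u x) :
    densityMeasure Ω u = ENNReal.ofReal c • densityMeasure Ω ρ +
      densityMeasure Ω fun x => u x - c * ρ x := by
  have hm : AEMeasurable (fun x => ENNReal.ofReal c * ENNReal.ofReal (ρ x))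
      (volume.restrict Ω) := (hρ.aestronglyMeasurable.aemeasurable.ennreal_ofReal).const_mul _
  have hs : ENNReal.ofReal c • densityMeasure Ω ρ =
      (volume.restrict Ω).withDensity fun x => ENNReal.ofReal c * ENNReal.ofReal (ρ x) :=
    (withDensity_smul' _ _ ENNReal.ofReal_ne_top).symm
  rw [hs]
  ext s hs
  rw [Measure.add_apply, densityMeasure, densityMeasure, withDensity_apply _ hs,
    withDensity_apply _ hs, withDensity_apply _ hs, ← lintegral_add_left' hm.restrict]
  refine lintegral_congr_ae (ae_restrict_of_ae (ae_restrict_of_forall_mem hΩ fun x hx => ?_))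
  change ENNReal.ofReal (u x) =
    ENNReal.ofReal c * ENNReal.ofReal (ρ x) + ENNReal.ofReal (u x - c * ρ x)
  rw [← ENNReal.ofReal_mul hc, ← ENNReal.ofReal_add (mul_nonneg hc (hρ0 x hx))
    (sub_nonneg.2 (h x hx)), add_sub_cancel]

theorem wasserstein2_sq (μ ν : Measure (EuclideanSpace ℝ (Fin n))) :
    wasserstein2 μ ν ^ 2 = (kantorovichCost μ ν).toReal :=
  Real.sq_sqrt ENNReal.toReal_nonneg

theorem wasserstein2_sq_le {k : ℕ} (hΩ : IsCompact Ω) {u ρ π : EuclideanSpace ℝ (Fin n) → ℝ}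
    (hu : IsCkProbDensity k Ω u) (hρ : IsCkProbDensity k Ω ρ) (hπ : IsCkProbDensity k Ω π)
    {c : ℝ} (hc : 0 ≤ c) (h : ∀ x ∈ Ω, c * ρ x ≤ u x) :
    wasserstein2 (densityMeasure Ω u) (densityMeasure Ω π) ^ 2 ≤
      wasserstein2 (densityMeasure Ω ρ) (densityMeasure Ω π) ^ 2 +
        Metric.diam Ω ^ 2 * (1 - c) := by
  have hm := hΩ.measurableSet
  have := hρ.isProbabilityMeasure hm
  have := hπ.isProbabilityMeasure hm
  have hint : IntegrableOn (fun x => u x - c * ρ x) Ω :=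
    hu.integrableOn.sub (hρ.integrableOn.const_mul c)
  have hI : ∫ x in Ω, (u x - c * ρ x) = 1 - c := by
    rw [integral_sub hu.integrableOn (hρ.integrableOn.const_mul c), integral_const_mul,
      hu.integral_eq_one, hρ.integral_eq_one, mul_one]
  have hη := densityMeasure_univ hm hint fun x hx => sub_nonneg.2 (h x hx)
  rw [hI] at hη
  have hc1 : 0 ≤ 1 - c := by
    rw [← hI]
    exact setIntegral_nonneg hm fun x hx => sub_nonneg.2 (h x hx)
  -- Finiteness matters because `toReal` sends `∞` to 0.
  have hfin : kantorovichCost (densityMeasure Ω ρ) (densityMeasure Ω π) ≠ ∞ := by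
    refine ne_top_of_le_ne_top ?_ ((kantorovichCost_le_lintegral_prod _ _).trans
      (lintegral_prod_densityMeasure_le hΩ ρ π))
    simp
  have hle : kantorovichCost (densityMeasure Ω u) (densityMeasure Ω π) ≤
      kantorovichCost (densityMeasure Ω ρ) (densityMeasure Ω π) +
        ENNReal.ofReal (Metric.diam Ω ^ 2 * (1 - c)) := by
    rw [densityMeasure_eq_smul_add hm hρ.integrableOn hρ.nonneg hc h]
    refine (kantorovichCost_smul_add_le ?_).trans ?_
    · rw [hη, ← ENNReal.ofReal_add hc hc1, add_sub_cancel, ENNReal.ofReal_one]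
    · gcongr
      refine (lintegral_prod_densityMeasure_le hΩ _ π).trans_eq ?_
      rw [hη, measure_univ, mul_one, ← ENNReal.ofReal_mul (sq_nonneg _)]
  have hnn : 0 ≤ Metric.diam Ω ^ 2 * (1 - c) := mul_nonneg (sq_nonneg _) hc1
  rw [wasserstein2_sq, wasserstein2_sq]
  refine (ENNReal.toReal_mono (ENNReal.add_ne_top.2 ⟨hfin, ENNReal.ofReal_ne_top⟩) hle).trans_eq ?_
  rw [ENNReal.toReal_add hfin ENNReal.ofReal_ne_top, ENNReal.toReal_ofReal hnn]

theorem exists_forall_integral_comp_le (hΩ : IsCompact Ω)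
    {φ : EuclideanSpace ℝ (Fin n) → ℝ → ℝ}
    (hφ : ContinuousOn (fun p : EuclideanSpace ℝ (Fin n) × ℝ => φ p.1 p.2) (Ω ×ˢ Set.Ici 0))
    {ρ : EuclideanSpace ℝ (Fin n) → ℝ} (hρ : ContinuousOn ρ Ω) (hρ0 : ∀ x ∈ Ω, 0 ≤ ρ x)
    {ε : ℝ} (hε : 0 < ε) :
    ∃ δ > 0, ∀ u : EuclideanSpace ℝ (Fin n) → ℝ, ContinuousOn u Ω → (∀ x ∈ Ω, 0 ≤ u x) →
      (∀ x ∈ Ω, |u x - ρ x| ≤ δ) → ∫ x in Ω, φ x (u x) ≤ (∫ x in Ω, φ x (ρ x)) + ε := by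
  obtain ⟨M, hM⟩ := hΩ.exists_bound_of_continuousOn hρ
  -- The radius `δ` will be at most 1, so all values of `u` stay in `[0, M + 1]`.
  have huc := (hΩ.prod isCompact_Icc).uniformContinuousOn_of_continuous
    (hφ.mono (Set.prod_mono_right (Set.Icc_subset_Ici_self : Set.Icc 0 (M + 1) ⊆ _)))
  have hV : 0 < volume.real Ω + 1 := by positivity
  obtain ⟨δ, hδ, hδφ⟩ := Metric.uniformContinuousOn_iff_le.1 huc (ε / (volume.real Ω + 1))
    (by positivity)
  refine ⟨min δ 1, by positivity, fun u hu hu0 huρ => ?_⟩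
  have hcomp : ∀ w : EuclideanSpace ℝ (Fin n) → ℝ, ContinuousOn w Ω → (∀ x ∈ Ω, 0 ≤ w x) →
      IntegrableOn (fun x => φ x (w x)) Ω := fun w hw hw0 =>
    (hφ.comp (continuousOn_id.prodMk hw) fun x hx => ⟨hx, hw0 x hx⟩).integrableOn_compact hΩ
  have hb : ‖∫ x in Ω, (φ x (u x) - φ x (ρ x))‖ ≤
      ε / (volume.real Ω + 1) * volume.real Ω := by
    refine norm_setIntegral_le_of_norm_le_const hΩ.measure_lt_top fun x hx => ?_
    have h1 := abs_le.1 (huρ x hx)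
    have h2 := (abs_le.1 (hM x hx)).2
    have h3 := min_le_right δ 1
    refine hδφ (x, u x) ⟨hx, hu0 x hx, by linarith⟩ (x, ρ x) ⟨hx, hρ0 x hx, by linarith⟩ ?_
    simpa [Prod.dist_eq, Real.dist_eq, hδ.le] using (huρ x hx).trans (min_le_left _ _)
  rw [integral_sub (hcomp u hu hu0) (hcomp ρ hρ hρ0)] at hb
  have h4 : ε / (volume.real Ω + 1) * volume.real Ω ≤ ε := by
    rw [div_mul_eq_mul_div, div_le_iff₀ hV]
    linarith
  linarith [(abs_le.1 hb).2]

theorem contDiff_neuralNetwork {N k : ℕ} {σ : ℝ → ℝ} (hσ : ContDiff ℝ k σ) (a : Fin N → ℝ)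
    (y : Fin N → EuclideanSpace ℝ (Fin n)) (θ : Fin N → ℝ) :
    ContDiff ℝ k (neuralNetwork σ a y θ) :=
  ContDiff.sum fun _ _ => contDiff_const.mul
    (hσ.comp ((contDiff_const.inner ℝ contDiff_id).add contDiff_const))

theorem exists_neuralNetwork_normalizeOn_approx {k : ℕ} (hΩ : IsCompact Ω) {σ : ℝ → ℝ}
    (hσc : Continuous σ) (hσ : ¬ ∃ p : Polynomial ℝ, ∀ t, σ t = p.eval t)
    {ρ : EuclideanSpace ℝ (Fin n) → ℝ} (hρ : IsCkProbDensity k Ω ρ) {α : ℝ} (hα : 0 < α) :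
    ∃ (N : ℕ) (a : Fin N → ℝ) (y : Fin N → EuclideanSpace ℝ (Fin n)) (θ : Fin N → ℝ),
      (∀ x ∈ Ω, ρ x ≤ neuralNetwork σ a y θ x) ∧
      1 ≤ ∫ x in Ω, neuralNetwork σ a y θ x ∧
      1 - (∫ x in Ω, neuralNetwork σ a y θ x)⁻¹ ≤ α ∧
      ∀ x ∈ Ω, |normalizeOn Ω (neuralNetwork σ a y θ) x - ρ x| ≤ α := by
  have hρc := hρ.contDiffOn.continuousOn
  obtain ⟨M', hM'⟩ := hΩ.exists_bound_of_continuousOn hρc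
  obtain ⟨M, hM0, hM⟩ : ∃ M, 0 ≤ M ∧ ∀ x ∈ Ω, ρ x ≤ M :=
    ⟨max M' 0, le_max_right _ _, fun x hx =>
      ((le_abs_self _).trans (hM' x hx)).trans (le_max_left _ _)⟩
  set V := volume.real Ω
  have hV : 0 ≤ V := measureReal_nonneg
  -- From `|Z⁻¹ u - ρ| ≤ (u - ρ) + (1 - Z⁻¹) u`, with `u - ρ ≤ 2δ`, `1 - Z⁻¹ ≤ 2Vδ` and `u ≤ M + 2`.
  have hK : 0 < (M + 2) * (2 * V) + 2 := by positivity
  obtain ⟨δ, hδ, hδ1, hδα⟩ : ∃ δ > 0, δ ≤ 1 ∧ δ * ((M + 2) * (2 * V) + 2) ≤ α :=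
    ⟨min 1 (α / ((M + 2) * (2 * V) + 2)), by positivity, min_le_left _ _,
      (le_div_iff₀ hK).1 (min_le_right _ _)⟩
  obtain ⟨N, a, y, θ, hu⟩ := exists_neuralNetwork_approx hΩ hσc hσ
    (hρc.add (continuousOn_const (c := δ))) hδ
  replace hu : ∀ x ∈ Ω, |neuralNetwork σ a y θ x - (ρ x + δ)| < δ := hu
  refine ⟨N, a, y, θ, ?_⟩
  have huc : Continuous (neuralNetwork σ a y θ) := by unfold neuralNetwork; fun_prop
  unfold normalizeOn
  set u := neuralNetwork σ a y θ
  have hlow : ∀ x ∈ Ω, ρ x ≤ u x := fun x hx => by linarith [(abs_lt.1 (hu x hx)).1]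
  have hupp : ∀ x ∈ Ω, u x ≤ ρ x + 2 * δ := fun x hx => by linarith [(abs_lt.1 (hu x hx)).2]
  have hui : IntegrableOn u Ω := huc.continuousOn.integrableOn_compact hΩ
  have hci : IntegrableOn (fun _ => 2 * δ) Ω := continuousOn_const.integrableOn_compact hΩ
  have hZ1 : 1 ≤ ∫ x in Ω, u x := by
    rw [← hρ.integral_eq_one]
    exact setIntegral_mono_on hρ.integrableOn hui hΩ.measurableSet hlow
  have hZ2 : ∫ x in Ω, u x ≤ 1 + V * (2 * δ) := by
    have := setIntegral_mono_on hui (hρ.integrableOn.add hci) hΩ.measurableSet hupp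
    rw [Pi.add_def, integral_add hρ.integrableOn hci, hρ.integral_eq_one, setIntegral_const,
      smul_eq_mul] at this
    exact this
  set Z := ∫ x in Ω, u x
  have hZinv : 1 - Z⁻¹ ≤ V * (2 * δ) := by
    have : 1 - Z⁻¹ ≤ Z - 1 := by
      have h1 : Z * Z⁻¹ = 1 := mul_inv_cancel₀ (by positivity)
      have h2 : Z⁻¹ ≤ 1 := inv_le_one_of_one_le₀ hZ1
      nlinarith
    linarith
  have hZinv0 : 0 ≤ 1 - Z⁻¹ := sub_nonneg.2 (inv_le_one_of_one_le₀ hZ1)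
  have hVδ : 0 ≤ V * δ := by positivity
  refine ⟨hlow, hZ1, ?_, fun x hx => ?_⟩
  · nlinarith
  · have h1 : (1 - Z⁻¹) * u x ≤ V * (2 * δ) * (M + 2) :=
      mul_le_mul hZinv (by linarith [hupp x hx, hM x hx])
        ((hρ.nonneg x hx).trans (hlow x hx)) (by positivity)
    have h2 : 0 ≤ (1 - Z⁻¹) * u x :=
      mul_nonneg hZinv0 ((hρ.nonneg x hx).trans (hlow x hx))
    have h3 := hlow x hx
    have h4 := hupp x hx
    rw [abs_le]
    constructor <;> nlinarith

theorem isCkProbDensity_normalizeOn {k : ℕ} {u : EuclideanSpace ℝ (Fin n) → ℝ}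
    (hΩ : IsCompact Ω) (hu : ContDiffOn ℝ k u Ω) (hu0 : ∀ x ∈ Ω, 0 ≤ u x)
    (hZ : 0 < ∫ x in Ω, u x) : IsCkProbDensity k Ω (normalizeOn Ω u) where
  contDiffOn := contDiffOn_const.mul hu
  nonneg x hx := mul_nonneg (inv_nonneg.2 hZ.le) (hu0 x hx)
  integrableOn := (hu.continuousOn.integrableOn_compact hΩ).const_mul _
  integral_eq_one := by
    unfold normalizeOn
    rw [integral_const_mul, inv_mul_cancel₀ hZ.ne']

end Density

theorem mainTheorem3 (n k : ℕ) (Ω : Set (EuclideanSpace ℝ (Fin n))) (hΩ : IsCompact Ω)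
    (φ : EuclideanSpace ℝ (Fin n) → ℝ → ℝ)
    (hφ : ContinuousOn (fun p : EuclideanSpace ℝ (Fin n) × ℝ => φ p.1 p.2) (Ω ×ˢ Set.Ici 0))
    (τ : ℝ) (hτ : 0 < τ)
    (σ : ℝ → ℝ) (hσ : ContDiff ℝ k σ)
    (hσ_nonpoly : ¬ ∃ p : Polynomial ℝ, ∀ t, σ t = p.eval t)
    (ρ π : EuclideanSpace ℝ (Fin n) → ℝ)
    (hρ : IsCkProbDensity k Ω ρ) (hπ : IsCkProbDensity k Ω π)
    (ε : ℝ) (hε : 0 < ε) :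
    ∃ (N : ℕ) (a : Fin N → ℝ) (y : Fin N → EuclideanSpace ℝ (Fin n)) (θ : Fin N → ℝ),
      (∀ x ∈ Ω, 0 ≤ neuralNetwork σ a y θ x) ∧
      0 < ∫ x in Ω, neuralNetwork σ a y θ x ∧
      IsCkProbDensity k Ω (normalizeOn Ω (neuralNetwork σ a y θ)) ∧
      eLpNorm (fun x => normalizeOn Ω (neuralNetwork σ a y θ) x - ρ x) ∞ (volume.restrict Ω)
        ≤ ENNReal.ofReal ε ∧
      jkoFunctional Ω φ τ π (normalizeOn Ω (neuralNetwork σ a y θ)) - jkoFunctional Ω φ τ π ρ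
        ≤ ε := by
  obtain ⟨δ, hδ, hδφ⟩ := exists_forall_integral_comp_le hΩ hφ hρ.contDiffOn.continuousOn
    hρ.nonneg (half_pos hε)
  set D := Metric.diam Ω ^ 2
  have hD : 0 ≤ D := sq_nonneg _
  -- The last bound makes the transport excess `D * α / (2 * τ)` at most `ε / 2`; the `φ` term uses
  -- the other half.
  obtain ⟨α, hα, hαδ, hαε, hατ⟩ : ∃ α > 0, α ≤ δ ∧ α ≤ ε ∧ D * α ≤ ε * τ := by
    refine ⟨min δ (min ε (ε * τ / (D + 1))), by positivity, min_le_left _ _,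
      (min_le_right _ _).trans (min_le_left _ _), ?_⟩
    have h := (le_div_iff₀ (show 0 < D + 1 by positivity)).1
      ((min_le_right δ _).trans (min_le_right ε (ε * τ / (D + 1))))
    have h0 : 0 ≤ min δ (min ε (ε * τ / (D + 1))) := by positivity
    linarith
  obtain ⟨N, a, y, θ, hlow, hZ, hZα, happrox⟩ :=
    exists_neuralNetwork_normalizeOn_approx hΩ hσ.continuous hσ_nonpoly hρ hα
  have hu0 : ∀ x ∈ Ω, 0 ≤ neuralNetwork σ a y θ x :=
    fun x hx => (hρ.nonneg x hx).trans (hlow x hx)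
  have hZ0 := zero_lt_one.trans_le hZ
  have hdens := isCkProbDensity_normalizeOn hΩ
    (contDiff_neuralNetwork hσ a y θ).contDiffOn hu0 hZ0
  refine ⟨N, a, y, θ, hu0, hZ0, hdens, ?_, ?_⟩
  · rw [eLpNorm_exponent_top]
    refine eLpNormEssSup_le_of_ae_bound
      (ae_restrict_of_forall_mem hΩ.measurableSet fun x hx => ?_)
    exact (happrox x hx).trans hαε
  · have hφu := hδφ _ hdens.contDiffOn.continuousOn hdens.nonneg
      fun x hx => (happrox x hx).trans hαδ
    have hW := wasserstein2_sq_le hΩ hdens hρ hπ (inv_nonneg.2 hZ0.le)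
      fun x hx => mul_le_mul_of_nonneg_left (hlow x hx) (inv_nonneg.2 hZ0.le)
    have hW' := hW.trans (add_le_add_right ((mul_le_mul_of_nonneg_left hZα hD).trans hατ) _)
    have hWτ := div_le_div_of_nonneg_right hW' (show 0 ≤ 2 * τ by positivity)
    have hετ : ε * τ / (2 * τ) = ε / 2 := by field_simp
    rw [add_div, hετ] at hWτ
    unfold jkoFunctional
    linarith
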